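/- Theorem. There is an absolute constant $C$ such that the following holds for every $n\ge 6$. Let $f\colon\mathbb R^n\to\mathbb R$ be differentiable and $L$-smooth with $L>0$ (i.e. $\|\nabla f(x)-\nabla f(y)\|\le L\|x-y\|$ for all $x,y$), let $\varepsilon\in(0,1/\sqrt2)$ and $\gamma>0$, let $x\in\mathbb R^n$ satisfy $\|\nabla f(x)\|\ge\gamma$, put $g=\nabla f(x)/\|\nabla f(x)\|$, and let $v\in\mathbb R^n$ be a unit vector for which it is promised that either $\|g-v\|\le\varepsilon$ or $\|g-v\|>2\varepsilon$. The function $f$ can be accessed only through a comparison oracle, that is, a function $O\colon\mathbb R^n\times\mathbb R^n\to\{-1,1\}$ such that $O(a,b)=1$ implies $f(a)\ge f(b)$ and $O(a,b)=-1$ implies $f(a)\le f(b)$ (an arbitrary answer is allowed on ties). For a unit vector $u$ and $\Delta>0$, the directional preference $\mathrm{DP}(x,u,\Delta)$ makes one query and reports "$\langle\nabla f(x),u\rangle\ge-\Delta$" if $O(x+\tfrac{2\Delta}{L}u,\,x)=1$, and "$\langle\nabla f(x),u\rangle\le\Delta$" otherwise. Consider the following algorithm, Classical Gradient Testing, in an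 orthonormal coordinate frame whose first vector is $v$ (any such frame may be used). Set $\Delta=\varepsilon\gamma/(25\sqrt2\,n)$, $\delta=1/3$, $T=\lceil 3200\ln(1/\delta)\rceil$ and $N=0$. For $i=1,\dots,T$, draw $y$ uniformly from the unit sphere of $\mathbb R^{n-1}$, independently of the previous draws, put $\alpha_y=\bigl(-\varepsilon/\sqrt{(n-1)(1-\varepsilon^2)},\,y\bigr)\in\mathbb R^n$, call $\mathrm{DP}(x,\alpha_y/\|\alpha_y\|,\Delta)$, and increase $N$ by $1$ if the report is "$\langle\nabla f(x),\alpha_y/\|\alpha_y\|\rangle\le\Delta$". Return Yes if $N/T\ge 63/80$, and No otherwise. Then the algorithm makes at most $C$ comparison queries for every outcome of the random draws, and with probability at least $2/3$ its answer is correct: Yes if $\|g-v\|\le\varepsilon$, and No if $\|g-v\|>2\varepsilon$. -/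

import Mathlib

/-- A differentiable function on `ℝⁿ` whose gradient is `L`-Lipschitz. -/
def IsLSmooth {n : ℕ} (L : ℝ) (f : EuclideanSpace ℝ (Fin n) → ℝ) : Prop :=
  Differentiable ℝ f ∧ ∀ x y, ‖gradient f x - gradient f y‖ ≤ L * ‖x - y‖

/-- The normalized gradient `∇f(x) / ‖∇f(x)‖`. -/
noncomputable def normalizedGradient {n : ℕ} (f : EuclideanSpace ℝ (Fin n) → ℝ)
    (x : EuclideanSpace ℝ (Fin n)) : EuclideanSpace ℝ (Fin n) :=
  ‖gradient f x‖⁻¹ • gradient f x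

/-- `O` is a comparison oracle for `f`. The answers `1` and `-1` are the two elements of `ℤˣ`;
on a tie either answer is allowed, and the choice may depend on the queried pair. -/
def IsComparisonOracle {X : Type} (f : X → ℝ) (O : X → X → ℤˣ) : Prop :=
  ∀ x y, (O x y = 1 → f y ≤ f x) ∧ (O x y = -1 → f x ≤ f y)

/-- Adaptive programs that interact with the unknown function only through a comparison oracle:
either stop with an output, or query the oracle on a pair of points and continue according to
the answer. -/
inductive ComparisonProgram (X : Type) (A : Type) : Type where
  | output (a : A) : ComparisonProgram X A
  | query (x y : X) (next : ℤˣ → ComparisonProgram X A) : ComparisonProgram X A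

/-- The output of a program when it is run with the oracle `O`. -/
def ComparisonProgram.run {X A : Type} (O : X → X → ℤˣ) : ComparisonProgram X A → A
  | .output a => a
  | .query x y next => (next (O x y)).run O

/-- The number of oracle queries that a program makes when it is run with the oracle `O`. -/
def ComparisonProgram.queryCount {X A : Type} (O : X → X → ℤˣ) : ComparisonProgram X A → ℕ
  | .output _ => 0
  | .query x y next => (next (O x y)).queryCount O + 1

/-- Run `p`, then continue with the program that `k` assigns to its output. -/
def ComparisonProgram.bind {X A B : Type} (p : ComparisonProgram X A)
    (k : A → ComparisonProgram X B) : ComparisonProgram X B :=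
  match p with
  | .output a => k a
  | .query x y next => .query x y (fun b => (next b).bind k)

/-- The two possible reports of directional preference: `⟨∇f(x), u⟩ ≥ -Δ` or `⟨∇f(x), u⟩ ≤ Δ`. -/
inductive Preference : Type where
  | atLeast
  | atMost

/-- Directional preference `DP(x, u, Δ)` for an `L`-smooth function: one comparison of
`x + (2Δ/L) u` with `x`. -/
noncomputable def directionalPreference {n : ℕ} (L : ℝ) (x u : EuclideanSpace ℝ (Fin n)) (Δ : ℝ) :
    ComparisonProgram (EuclideanSpace ℝ (Fin n)) Preference :=
  .query (x + (2 * Δ / L) • u) x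
    (fun b => if b = 1 then .output .atLeast else .output .atMost)

/-- Call directional preference at `x` on each direction of a list in turn, increasing the
counter `N` whenever the report is `⟨∇f(x), u⟩ ≤ Δ`; the output is the final counter. -/
noncomputable def preferenceLoop {n : ℕ} (L : ℝ) (x : EuclideanSpace ℝ (Fin n)) (Δ : ℝ) :
    List (EuclideanSpace ℝ (Fin n)) → ℕ → ComparisonProgram (EuclideanSpace ℝ (Fin n)) ℕ
  | [], N => .output N
  | u :: us, N => (directionalPreference L x u Δ).bind fun r =>
      match r with
      | .atLeast => preferenceLoop L x Δ us N
      | .atMost => preferenceLoop L x Δ us (N + 1)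

/-- The answers of a gradient tester. -/
inductive TestAnswer : Type where
  | yes
  | no

/-- Correctness of an answer for the target vector `v` and the normalized gradient `g`. -/
def IsCorrectAnswer {n : ℕ} (ε : ℝ) (g v : EuclideanSpace ℝ (Fin n)) : TestAnswer → Prop
  | .yes => ‖g - v‖ ≤ ε
  | .no => 2 * ε < ‖g - v‖

/-- The unit sphere of `ℝᵐ`. -/
abbrev UnitSphere (m : ℕ) : Type := Metric.sphere (0 : EuclideanSpace ℝ (Fin m)) 1

/-- The uniform distribution on the unit sphere of `ℝᵐ`: the normalized surface measure. -/
noncomputable def uniformSphere (m : ℕ) : MeasureTheory.Measure (UnitSphere m) :=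
  ((MeasureTheory.volume : MeasureTheory.Measure (EuclideanSpace ℝ (Fin m))).toSphere Set.univ)⁻¹ •
    (MeasureTheory.volume : MeasureTheory.Measure (EuclideanSpace ℝ (Fin m))).toSphere

/-- The number of rounds `T = ⌈3200 ln (1/δ)⌉` with `δ = 1/3`. -/
noncomputable def testRounds : ℕ := ⌈3200 * Real.log (1 / (1 / 3 : ℝ))⌉₊

/-- The distribution of the random directions `y₁, …, y_T`: independent, each uniform on the
unit sphere of `ℝᵐ`. -/
noncomputable def sampleLaw (m : ℕ) : MeasureTheory.Measure (Fin testRounds → UnitSphere m) :=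
  MeasureTheory.Measure.pi fun _ => uniformSphere m

/-- In dimension `n = m + 1`, the vector `α_y = (-ε / √((n-1)(1-ε²)), y)`. -/
noncomputable def testVector {m : ℕ} (ε : ℝ) (y : UnitSphere m) : EuclideanSpace ℝ (Fin (m + 1)) :=
  WithLp.toLp 2 (Fin.cons (-ε / √((m : ℝ) * (1 - ε ^ 2))) (fun i => y.1 i))

/-- Classical gradient testing in dimension `n = m + 1`, for the sampled directions `ys`.
The isometry `Q` is the coordinate frame in which the algorithm works: its first
vector `Q e₁` is the vector to be tested. -/
noncomputable def gradientTest {m : ℕ} (L ε γ : ℝ) (x : EuclideanSpace ℝ (Fin (m + 1)))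
    (Q : EuclideanSpace ℝ (Fin (m + 1)) ≃ₗᵢ[ℝ] EuclideanSpace ℝ (Fin (m + 1)))
    (ys : Fin testRounds → UnitSphere m) :
    ComparisonProgram (EuclideanSpace ℝ (Fin (m + 1))) TestAnswer :=
  (preferenceLoop L x (ε * γ / (25 * √2 * ((m : ℝ) + 1)))
      (List.ofFn fun i => Q (‖testVector ε (ys i)‖⁻¹ • testVector ε (ys i))) 0).bind
    fun N => .output (if 63 / 80 ≤ (N : ℝ) / (testRounds : ℝ) then .yes else .no)

/-- Every unit vector is the first vector of some orthonormal coordinate frame. -/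
theorem exists_frame {m : ℕ} (v : EuclideanSpace ℝ (Fin (m + 1))) (hv : ‖v‖ = 1) :
    ∃ Q : EuclideanSpace ℝ (Fin (m + 1)) ≃ₗᵢ[ℝ] EuclideanSpace ℝ (Fin (m + 1)),
      Q (EuclideanSpace.single 0 1) = v :=
  ⟨_, Submodule.reflection_sub (v := EuclideanSpace.single 0 1) (w := v) (by simp [hv])⟩

/-- In positive dimension the uniform distribution on the sphere has total mass one. -/
theorem isProbabilityMeasure_uniformSphere {m : ℕ} (hm : 0 < m) :
    MeasureTheory.IsProbabilityMeasure (uniformSphere m) := by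
  have : Nonempty (Fin m) := ⟨⟨0, hm⟩⟩
  refine ⟨?_⟩
  simp only [uniformSphere, MeasureTheory.Measure.smul_apply, smul_eq_mul]
  refine ENNReal.inv_mul_cancel ?_ (MeasureTheory.measure_ne_top _ _)
  rw [MeasureTheory.Measure.measure_univ_ne_zero]
  exact MeasureTheory.Measure.toSphere_ne_zero _

/-! In the frame with first vector `v`, write g as (h₀, w), so that h₀² + ‖w‖² = 1 and ‖g - v‖² = 2
- 2h₀. With m = n - 1 and a = ε/√(m(1-ε²)), each round tests the sign of -a h₀ + ⟨w, y⟩. Here ⟨w, y⟩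
is ‖w‖ times one coordinate of a uniform point of the sphere, hence of size about ‖w‖/√m. If g is
close to v, then h₀ ≥ √(1-ε²) and ‖w‖ ≤ ε, so the quantity is negative unless that coordinate
exceeds about 1/√m. If g is far, ‖w‖ is roughly twice as large or h₀ is negative, and about half
that height already makes it positive.

Two quantitative facts finish the argument. The cap above height 0.98/√m has measure at most 1/5,
and the cap above 0.515/√m at least 9/40; both come from the one-dimensional density
(1-t²)^((m-3)/2). The heights 0.98 and 0.515, instead of 1 and 1/2, leave a margin ε/(64√m) that
absorbs the error Δ of directional preference. So the report `atMost` has probability at least 4/5 =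
64/80 in the close case and at most 31/40 = 62/80 in the far case. Hoeffding's inequality with
deviation 1/80 separates both from the threshold 63/80. Each round costs one query and the number of
rounds does not depend on n. -/

open MeasureTheory ProbabilityTheory
open scoped RealInnerProductSpace ENNReal Pointwise

/-! ### Semantics and query count of the algorithm -/

namespace ComparisonProgram

theorem run_bind {X A B : Type} (O : X → X → ℤˣ) (p : ComparisonProgram X A)
    (k : A → ComparisonProgram X B) : (p.bind k).run O = (k (p.run O)).run O := by
  induction p with
  | output a => rfl
  | query x y next ih => exact ih _

theorem queryCount_bind {X A B : Type} (O : X → X → ℤˣ) (p : ComparisonProgram X A)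
    (k : A → ComparisonProgram X B) :
    (p.bind k).queryCount O = p.queryCount O + (k (p.run O)).queryCount O := by
  induction p with
  | output a => simp [ComparisonProgram.bind, queryCount, run]
  | query x y next ih =>
    simp only [ComparisonProgram.bind, queryCount, run, ih]
    omega

end ComparisonProgram

theorem queryCount_directionalPreference {n : ℕ} (L : ℝ) (x u : EuclideanSpace ℝ (Fin n)) (Δ : ℝ)
    (O : EuclideanSpace ℝ (Fin n) → EuclideanSpace ℝ (Fin n) → ℤˣ) :
    (directionalPreference L x u Δ).queryCount O = 1 := by
  simp only [directionalPreference, ComparisonProgram.queryCount]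
  split_ifs <;> rfl

theorem run_directionalPreference {n : ℕ} (L : ℝ) (x u : EuclideanSpace ℝ (Fin n)) (Δ : ℝ)
    (O : EuclideanSpace ℝ (Fin n) → EuclideanSpace ℝ (Fin n) → ℤˣ) :
    (directionalPreference L x u Δ).run O =
      if O (x + (2 * Δ / L) • u) x = 1 then .atLeast else .atMost := by
  simp only [directionalPreference, ComparisonProgram.run]
  split_ifs <;> rfl

theorem queryCount_preferenceLoop {n : ℕ} (L : ℝ) (x : EuclideanSpace ℝ (Fin n)) (Δ : ℝ)
    (O : EuclideanSpace ℝ (Fin n) → EuclideanSpace ℝ (Fin n) → ℤˣ)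
    (us : List (EuclideanSpace ℝ (Fin n))) (N : ℕ) :
    (preferenceLoop L x Δ us N).queryCount O = us.length := by
  induction us generalizing N with
  | nil => rfl
  | cons u us ih =>
    simp only [preferenceLoop, ComparisonProgram.queryCount_bind,
      queryCount_directionalPreference, run_directionalPreference]
    split_ifs <;> simp [ih, add_comm]

theorem run_preferenceLoop {n : ℕ} (L : ℝ) (x : EuclideanSpace ℝ (Fin n)) (Δ : ℝ)
    (O : EuclideanSpace ℝ (Fin n) → EuclideanSpace ℝ (Fin n) → ℤˣ)
    (us : List (EuclideanSpace ℝ (Fin n))) (N : ℕ) :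
    (preferenceLoop L x Δ us N).run O =
      N + (us.map fun u => if O (x + (2 * Δ / L) • u) x = 1 then 0 else 1).sum := by
  induction us generalizing N with
  | nil => rfl
  | cons u us ih =>
    simp only [preferenceLoop, ComparisonProgram.run_bind, run_directionalPreference,
      List.map_cons, List.sum_cons]
    split_ifs <;> simp [ih, add_assoc]

theorem queryCount_gradientTest {m : ℕ} (L ε γ : ℝ) (x : EuclideanSpace ℝ (Fin (m + 1)))
    (Q : EuclideanSpace ℝ (Fin (m + 1)) ≃ₗᵢ[ℝ] EuclideanSpace ℝ (Fin (m + 1)))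
    (O : EuclideanSpace ℝ (Fin (m + 1)) → EuclideanSpace ℝ (Fin (m + 1)) → ℤˣ)
    (ys : Fin testRounds → UnitSphere m) :
    (gradientTest L ε γ x Q ys).queryCount O = testRounds := by
  simp [gradientTest, ComparisonProgram.queryCount_bind, queryCount_preferenceLoop,
    ComparisonProgram.queryCount]

theorem run_gradientTest {m : ℕ} (L ε γ : ℝ) (x : EuclideanSpace ℝ (Fin (m + 1)))
    (Q : EuclideanSpace ℝ (Fin (m + 1)) ≃ₗᵢ[ℝ] EuclideanSpace ℝ (Fin (m + 1)))
    (O : EuclideanSpace ℝ (Fin (m + 1)) → EuclideanSpace ℝ (Fin (m + 1)) → ℤˣ)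
    (ys : Fin testRounds → UnitSphere m) :
    (gradientTest L ε γ x Q ys).run O =
      if 63 / 80 ≤ (∑ i, (if O (x + (2 * (ε * γ / (25 * √2 * ((m : ℝ) + 1))) / L) •
          Q (‖testVector ε (ys i)‖⁻¹ • testVector ε (ys i))) x = 1 then 0 else 1 : ℝ)) /
            (testRounds : ℝ)
      then .yes else .no := by
  simp only [gradientTest, ComparisonProgram.run_bind, run_preferenceLoop,
    ComparisonProgram.run, List.map_ofFn, List.sum_ofFn, Function.comp_def]
  congr! 3
  push_cast
  simp

/-! ### Smoothness and the meaning of directional preference -/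

/-- The function t ↦ f(x + th) - t⟨∇f(x), h⟩ - (L/2)‖h‖²t² has nonpositive derivative on (0, 1), by
Cauchy–Schwarz and the Lipschitz bound; compare its values at 0 and 1. -/
theorem IsLSmooth.le_quadratic {n : ℕ} {L : ℝ} {f : EuclideanSpace ℝ (Fin n) → ℝ}
    (hf : IsLSmooth L f) (x h : EuclideanSpace ℝ (Fin n)) :
    f (x + h) ≤ f x + ⟪gradient f x, h⟫ + L / 2 * ‖h‖ ^ 2 := by
  have hd (t : ℝ) : HasDerivAt
      (fun t : ℝ => f (x + t • h) - t * ⟪gradient f x, h⟫ - L / 2 * ‖h‖ ^ 2 * t ^ 2)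
      (⟪gradient f (x + t • h) - gradient f x, h⟫ - L * ‖h‖ ^ 2 * t) t := by
    have h1 : HasDerivAt (fun t : ℝ => x + t • h) h t := by
      simpa using ((hasDerivAt_id t).smul_const h).const_add x
    have h2 := ((hf.1 (x + t • h)).hasGradientAt.hasFDerivAt).comp_hasDerivAt t h1
    have h3 := (h2.sub ((hasDerivAt_id t).mul_const ⟪gradient f x, h⟫)).sub
      ((hasDerivAt_pow 2 t).const_mul (L / 2 * ‖h‖ ^ 2))
    refine h3.congr_deriv ?_
    rw [inner_sub_left, InnerProductSpace.toDual_apply_apply]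
    push_cast
    ring
  have hanti : AntitoneOn
      (fun t : ℝ => f (x + t • h) - t * ⟪gradient f x, h⟫ - L / 2 * ‖h‖ ^ 2 * t ^ 2)
      (Set.Icc 0 1) := by
    refine antitoneOn_of_deriv_nonpos (convex_Icc 0 1)
      (fun t _ => (hd t).continuousAt.continuousWithinAt)
      (fun t _ => (hd t).differentiableAt.differentiableWithinAt) fun t ht => ?_
    rw [interior_Icc] at ht
    rw [(hd t).deriv]
    have h4 := hf.2 (x + t • h) x
    rw [add_sub_cancel_left, norm_smul, Real.norm_of_nonneg ht.1.le] at h4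
    have h5 := real_inner_le_norm (gradient f (x + t • h) - gradient f x) h
    nlinarith [mul_le_mul_of_nonneg_right h4 (norm_nonneg h)]
  have := hanti (Set.left_mem_Icc.2 zero_le_one) (Set.right_mem_Icc.2 zero_le_one) zero_le_one
  simp only [one_smul, zero_smul, add_zero, one_mul, zero_mul, one_pow, mul_one, sub_zero, ne_eq,
    OfNat.ofNat_ne_zero, not_false_eq_true, zero_pow, mul_zero] at this
  linarith

theorem IsLSmooth.neg {n : ℕ} {L : ℝ} {f : EuclideanSpace ℝ (Fin n) → ℝ}
    (hf : IsLSmooth L f) : IsLSmooth L (fun x => -f x) := by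
  have hg (x) : gradient (fun x => -f x) x = -gradient f x := by
    simp [gradient]
  refine ⟨hf.1.neg, fun x y => ?_⟩
  rw [hg, hg, ← neg_sub', norm_neg]
  exact hf.2 x y

theorem IsLSmooth.quadratic_le {n : ℕ} {L : ℝ} {f : EuclideanSpace ℝ (Fin n) → ℝ}
    (hf : IsLSmooth L f) (x h : EuclideanSpace ℝ (Fin n)) :
    f x + ⟪gradient f x, h⟫ - L / 2 * ‖h‖ ^ 2 ≤ f (x + h) := by
  have hg : gradient (fun x => -f x) x = -gradient f x := by
    simp [gradient]
  have := hf.neg.le_quadratic x h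
  rw [hg, inner_neg_left] at this
  linarith

/-- At step length 2Δ/L the quadratic error is exactly (2Δ/L)Δ, so a slope below -Δ gives a strict
decrease and the tie rule plays no role. -/
theorem oracle_ne_one_of_inner_lt {n : ℕ} {L Δ : ℝ} (hL : 0 < L) (hΔ : 0 < Δ)
    {f : EuclideanSpace ℝ (Fin n) → ℝ} (hf : IsLSmooth L f)
    {O : EuclideanSpace ℝ (Fin n) → EuclideanSpace ℝ (Fin n) → ℤˣ} (hO : IsComparisonOracle f O)
    {x u : EuclideanSpace ℝ (Fin n)} (hu : ‖u‖ = 1) (h : ⟪gradient f x, u⟫ < -Δ) :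
    O (x + (2 * Δ / L) • u) x ≠ 1 := by
  intro h1
  have h2 := (hO _ _).1 h1
  have h3 := hf.le_quadratic x ((2 * Δ / L) • u)
  rw [inner_smul_right, norm_smul, hu, mul_one, Real.norm_of_nonneg (by positivity)] at h3
  have h4 : L / 2 * (2 * Δ / L) ^ 2 = 2 * Δ / L * Δ := by field_simp
  have h5 : 0 < 2 * Δ / L := by positivity
  nlinarith

theorem oracle_eq_one_of_lt_inner {n : ℕ} {L Δ : ℝ} (hL : 0 < L) (hΔ : 0 < Δ)
    {f : EuclideanSpace ℝ (Fin n) → ℝ} (hf : IsLSmooth L f)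
    {O : EuclideanSpace ℝ (Fin n) → EuclideanSpace ℝ (Fin n) → ℤˣ} (hO : IsComparisonOracle f O)
    {x u : EuclideanSpace ℝ (Fin n)} (hu : ‖u‖ = 1) (h : Δ < ⟪gradient f x, u⟫) :
    O (x + (2 * Δ / L) • u) x = 1 := by
  refine (Int.units_eq_one_or _).resolve_right fun h1 => ?_
  have h2 := (hO _ _).2 h1
  have h3 := hf.quadratic_le x ((2 * Δ / L) • u)
  rw [inner_smul_right, norm_smul, hu, mul_one, Real.norm_of_nonneg (by positivity)] at h3
  have h4 : L / 2 * (2 * Δ / L) ^ 2 = 2 * Δ / L * Δ := by field_simp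
  have h5 : 0 < 2 * Δ / L := by positivity
  nlinarith

/-! ### Integrals of powers of √(1 - t²) -/

theorem hasDerivAt_sqrt_one_sub_sq_pow (k : ℕ) {t : ℝ} (h0 : -1 < t) (h1 : t < 1) :
    HasDerivAt (fun t : ℝ => √(1 - t ^ 2) ^ (k + 2)) (-((k : ℝ) + 2) * t * √(1 - t ^ 2) ^ k) t := by
  have hpos : 0 < 1 - t ^ 2 := by nlinarith
  have h2 : HasDerivAt (fun t : ℝ => 1 - t ^ 2) (-(2 * t)) t := by
    simpa using (hasDerivAt_pow 2 t).const_sub 1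
  have h3 := (h2.sqrt hpos.ne').pow (k + 2)
  refine h3.congr_deriv ?_
  have h4 : √(1 - t ^ 2) ≠ 0 := (Real.sqrt_pos.2 hpos).ne'
  rw [show k + 2 - 1 = k + 1 by omega, pow_succ]
  push_cast
  field_simp

theorem sqrt_one_sub_sq_pow_add_two (k : ℕ) {t : ℝ} (h0 : -1 ≤ t) (h1 : t ≤ 1) :
    √(1 - t ^ 2) ^ (k + 2) = (1 - t ^ 2) * √(1 - t ^ 2) ^ k := by
  rw [pow_add, Real.sq_sqrt (by nlinarith), mul_comm]

/-- Integration by parts for the powers of `√(1 - t²)`. -/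
theorem integral_sqrt_one_sub_sq_pow_add_two (k : ℕ) {c : ℝ} (h0 : 0 ≤ c) (h1 : c ≤ 1) :
    ((k : ℝ) + 3) * ∫ t in c..1, √(1 - t ^ 2) ^ (k + 2) =
      ((k : ℝ) + 2) * (∫ t in c..1, √(1 - t ^ 2) ^ k) - c * √(1 - c ^ 2) ^ (k + 2) := by
  have h2 : ∫ t in c..1, (((k : ℝ) + 3) * √(1 - t ^ 2) ^ (k + 2) - ((k : ℝ) + 2) * √(1 - t ^ 2) ^ k) =
      1 * √(1 - 1 ^ 2) ^ (k + 2) - c * √(1 - c ^ 2) ^ (k + 2) := by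
    refine intervalIntegral.integral_eq_sub_of_hasDerivAt_of_le
      (f := fun t => t * √(1 - t ^ 2) ^ (k + 2)) h1 (by fun_prop) (fun t ht => ?_)
      (Continuous.intervalIntegrable (by fun_prop) _ _)
    have hd := (hasDerivAt_id t).mul
      (hasDerivAt_sqrt_one_sub_sq_pow k (t := t) (by linarith [ht.1]) ht.2)
    refine hd.congr_deriv ?_
    have := sqrt_one_sub_sq_pow_add_two k (t := t) (by linarith [ht.1]) ht.2.le
    simp only [id, this]
    ring
  rw [intervalIntegral.integral_sub, intervalIntegral.integral_const_mul,
    intervalIntegral.integral_const_mul] at h2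
  · simp at h2
    linarith
  all_goals exact Continuous.intervalIntegrable (by fun_prop) _ _

/-- A Mills-ratio bound: the right side, as a function of c, vanishes at 1 and decreases at least as
fast as the integrand. That comparison amounts to 2 + (k-1)t² - 2tr - (k+3)r² ≥ 0, and 5/3 is the
largest constant for which this holds at k = 2 for all t in (0, 1). -/
theorem integral_tail_le (k : ℕ) (hk : 2 ≤ k) {c r : ℝ} (h0 : 0 ≤ c) (h1 : c ≤ 1) (hr : 0 < r)
    (hr2 : ((k : ℝ) + 3) * r ^ 2 ≤ 5 / 3) :
    ∫ t in c..1, √(1 - t ^ 2) ^ k ≤ 2 / ((k : ℝ) + 3) / (c + r) * √(1 - c ^ 2) ^ (k + 2) := by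
  have hk' : (2 : ℝ) ≤ k := by exact_mod_cast hk
  have key := intervalIntegral.integral_le_sub_of_hasDeriv_right_of_le
    (g := fun t => -(2 / ((k : ℝ) + 3) / (t + r) * √(1 - t ^ 2) ^ (k + 2)))
    (g' := fun t => -(-(2 / ((k : ℝ) + 3)) / (t + r) ^ 2 * √(1 - t ^ 2) ^ (k + 2) +
      2 / ((k : ℝ) + 3) / (t + r) * (-((k : ℝ) + 2) * t * √(1 - t ^ 2) ^ k)))
    (φ := fun t => √(1 - t ^ 2) ^ k) h1 ?_ ?_ ?_ ?_
  · simpa using key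
  · refine ContinuousOn.neg (ContinuousOn.mul (ContinuousOn.div continuousOn_const (by fun_prop) ?_) (by fun_prop))
    intro t ht
    linarith [ht.1]
  · intro t ht
    have hne : t + r ≠ 0 := by linarith [ht.1]
    have h3 := ((hasDerivAt_const t (2 / ((k : ℝ) + 3))).div ((hasDerivAt_id t).add_const r) hne).mul
      (hasDerivAt_sqrt_one_sub_sq_pow k (t := t) (by linarith [ht.1]) ht.2)
    refine HasDerivAt.hasDerivWithinAt ?_
    refine h3.neg.congr_deriv ?_
    simp
  · exact (Continuous.integrableOn_Icc (by fun_prop))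
  · intro t ht
    have ht0 : 0 < t := by linarith [ht.1]
    simp only [sqrt_one_sub_sq_pow_add_two k (t := t) (by linarith) ht.2.le]
    have hpos : 0 ≤ √(1 - t ^ 2) ^ k := by positivity
    have h4 : 1 ≤ 2 / ((k : ℝ) + 3) / (t + r) ^ 2 * (1 - t ^ 2) +
        2 / ((k : ℝ) + 3) / (t + r) * (((k : ℝ) + 2) * t) := by
      have h5 : 2 / ((k : ℝ) + 3) / (t + r) ^ 2 * (1 - t ^ 2) +
        2 / ((k : ℝ) + 3) / (t + r) * (((k : ℝ) + 2) * t) =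
        (2 * (1 - t ^ 2) + 2 * (((k : ℝ) + 2) * t) * (t + r)) / (((k : ℝ) + 3) * (t + r) ^ 2) := by
        field_simp
      rw [h5, le_div_iff₀ (by positivity)]
      have h6 : 0 ≤ ((k : ℝ) - 2) * (((k : ℝ) - 1) * t ^ 2) := by
        have : 0 ≤ (k : ℝ) - 2 := by linarith
        have : 0 ≤ (k : ℝ) - 1 := by linarith
        positivity
      nlinarith [sq_nonneg (((k : ℝ) - 1) * t - r), sq_nonneg (t-r)]
    calc √(1 - t ^ 2) ^ k = 1 * √(1 - t ^ 2) ^ k := (one_mul _).symm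
      _ ≤ _ := mul_le_mul_of_nonneg_right h4 hpos
      _ = _ := by ring

/-- The polynomial rescales x + x³/3 + x⁵/15, the start of the series of exp(x²/2)∫₀ˣ exp(-u²/2) du,
with x = c√(k+3). Its product with √(1 - c²)^(k+2) grows no faster than the integral. -/
theorem le_integral_head (k : ℕ) {c : ℝ} (h0 : 0 ≤ c) (h1 : c ≤ 1) :
    (c + ((k : ℝ) + 3) * c ^ 3 / 3 + ((k : ℝ) + 3) ^ 2 * c ^ 5 / 15) * √(1 - c ^ 2) ^ (k + 2) ≤
      ∫ t in (0 : ℝ)..c, √(1 - t ^ 2) ^ k := by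
  have key := intervalIntegral.sub_le_integral_of_hasDeriv_right_of_le
    (g := fun t => (t + ((k : ℝ) + 3) * t ^ 3 / 3 + ((k : ℝ) + 3) ^ 2 * t ^ 5 / 15) *
      √(1 - t ^ 2) ^ (k + 2))
    (g' := fun t => (1 + ((k : ℝ) + 3) * t ^ 2 + ((k : ℝ) + 3) ^ 2 * t ^ 4 / 3) *
      √(1 - t ^ 2) ^ (k + 2) + (t + ((k : ℝ) + 3) * t ^ 3 / 3 + ((k : ℝ) + 3) ^ 2 * t ^ 5 / 15) *
      (-((k : ℝ) + 2) * t * √(1 - t ^ 2) ^ k))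
    (φ := fun t => √(1 - t ^ 2) ^ k) h0 ?_ ?_ ?_ ?_
  · simpa using key
  · fun_prop
  · intro t ht
    refine HasDerivAt.hasDerivWithinAt ?_
    have h3 := (((hasDerivAt_id t).add (((hasDerivAt_pow 3 t).const_mul ((k : ℝ) + 3)).div_const 3)).add
      (((hasDerivAt_pow 5 t).const_mul (((k : ℝ) + 3) ^ 2)).div_const 15)).mul
      (hasDerivAt_sqrt_one_sub_sq_pow k (t := t) (by linarith [ht.1]) (by linarith [ht.2]))
    refine h3.congr_deriv ?_
    simp only [Pi.add_apply, id]
    push_cast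
    ring
  · exact (Continuous.integrableOn_Icc (by fun_prop))
  · intro t ht
    have ht0 : 0 < t := ht.1
    simp only [sqrt_one_sub_sq_pow_add_two k (t := t) (by linarith) (by linarith [ht.2])]
    have hpos : 0 ≤ √(1 - t ^ 2) ^ k := by positivity
    have h4 : (1 + ((k : ℝ) + 3) * t ^ 2 + ((k : ℝ) + 3) ^ 2 * t ^ 4 / 3) * (1 - t ^ 2) -
        (t + ((k : ℝ) + 3) * t ^ 3 / 3 + ((k : ℝ) + 3) ^ 2 * t ^ 5 / 15) * (((k : ℝ) + 2) * t) ≤ 1 := by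
      have h5 : 0 ≤ 2 / 3 * ((k : ℝ) + 3) * t ^ 4 + ((k : ℝ) + 3) ^ 2 * t ^ 6 * ((k + 7) / 15) := by
        positivity
      linarith
    calc _ = _ * √(1 - t ^ 2) ^ k := by ring
      _ ≤ 1 * √(1 - t ^ 2) ^ k := mul_le_mul_of_nonneg_right h4 hpos
      _ = _ := one_mul _

/-- Bernoulli gives (1 - t²)^(k/2) ≥ 1 - kt²/2; integrate up to the zero √(2/k) of the right side.
-/
theorem le_integral_sqrt_one_sub_sq_pow (k : ℕ) (hk : 2 ≤ k) :
    2 / 3 * √(2 / k) ≤ ∫ t in (0 : ℝ)..1, √(1 - t ^ 2) ^ k := by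
  have hk' : (2 : ℝ) ≤ k := by exact_mod_cast hk
  set b := √(2 / (k : ℝ)) with hb
  have hb0 : 0 ≤ b := Real.sqrt_nonneg _
  have hb2 : b ^ 2 = 2 / k := Real.sq_sqrt (by positivity)
  have hb1 : b ≤ 1 := by
    rw [hb, Real.sqrt_le_one, div_le_one (by linarith)]
    exact hk'
  have h1 : ∫ t in (0 : ℝ)..b, (1 - k / 2 * t ^ 2) = 2 / 3 * b := by
    rw [intervalIntegral.integral_sub (by simp) (Continuous.intervalIntegrable (by fun_prop) _ _)]
    simp only [intervalIntegral.integral_const_mul, integral_pow]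
    simp
    have : b ^ 3 = b * (2 / k) := by rw [← hb2]; ring
    rw [this]
    field_simp
    ring
  rw [← h1]
  calc _ ≤ ∫ t in (0 : ℝ)..b, √(1 - t ^ 2) ^ k := by
        refine intervalIntegral.integral_mono_on hb0 (Continuous.intervalIntegrable (by fun_prop) _ _)
          (Continuous.intervalIntegrable (by fun_prop) _ _) fun t ht => ?_
        have ht1 : t ^ 2 ≤ 1 := by nlinarith [ht.1, ht.2]
        have h2 := one_add_mul_self_le_rpow_one_add (s := -t ^ 2) (by linarith) (p := (k : ℝ) / 2)
          (by linarith)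
        rw [Real.sqrt_eq_rpow, ← Real.rpow_mul_natCast (by linarith)]
        convert h2 using 1
        · ring
        · congr 1
          ring
    _ ≤ _ := by
        refine intervalIntegral.integral_mono_interval le_rfl hb0 hb1 ?_
          (Continuous.intervalIntegrable (by fun_prop) _ _)
        exact Filter.Eventually.of_forall fun t => by positivity

/-- Cap estimate at height `0.98 / √m`. -/
theorem integral_tail_le_integral (k : ℕ) (hk : 2 ≤ k) :
    ∫ t in (49 / 50 / √((k : ℝ) + 3))..1, √(1 - t ^ 2) ^ k ≤
      2 / 5 * ∫ t in (0 : ℝ)..1, √(1 - t ^ 2) ^ k := by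
  have hk' : (2 : ℝ) ≤ k := by exact_mod_cast hk
  set s := √((k : ℝ) + 3) with hs
  have hs2 : s ^ 2 = k + 3 := Real.sq_sqrt (by positivity)
  have hs1 : 1 < s := by
    rw [hs, Real.lt_sqrt zero_le_one]
    linarith
  set c := 49 / 50 / s with hc
  have hc0 : 0 ≤ c := by positivity
  have hc1 : c ≤ 1 := by
    rw [hc, div_le_one (by linarith)]
    linarith
  -- 1.28 lies just below √(5/3). Tail and head are now multiples of the same power, and tail ≤
  -- (2/3) head gives tail ≤ (2/5) total.
  have h1 := integral_tail_le k hk hc0 hc1 (r := 32 / 25 / s) (by positivity)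
    (by rw [← hs2]; field_simp; norm_num)
  have h2 := le_integral_head k hc0 hc1
  have h3 : 2 / ((k : ℝ) + 3) / (c + 32 / 25 / s) ≤ 2 / 3 *
      (c + ((k : ℝ) + 3) * c ^ 3 / 3 + ((k : ℝ) + 3) ^ 2 * c ^ 5 / 15) := by
    have e1 : 2 / ((k : ℝ) + 3) / (c + 32 / 25 / s) = 100 / 113 * (1 / s) := by
      rw [hc, ← hs2]; field_simp; norm_num
    have e2 : 2 / 3 * (c + ((k : ℝ) + 3) * c ^ 3 / 3 + ((k : ℝ) + 3) ^ 2 * c ^ 5 / 15) =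
        2 / 3 * (49 / 50 + (49 / 50) ^ 3 / 3 + (49 / 50) ^ 5 / 15) * (1 / s) := by
      rw [hc, ← hs2]; field_simp
    rw [e1, e2]
    refine mul_le_mul_of_nonneg_right (by norm_num) (by positivity)
  have h4 := mul_le_mul_of_nonneg_right h3 (show 0 ≤ √(1 - c ^ 2) ^ (k + 2) by positivity)
  have h5 := intervalIntegral.integral_add_adjacent_intervals (a := 0) (b := c) (c := 1)
    (f := fun t : ℝ => √(1 - t ^ 2) ^ k) (μ := MeasureTheory.volume)
    (Continuous.intervalIntegrable (by fun_prop) _ _)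
    (Continuous.intervalIntegrable (by fun_prop) _ _)
  linarith

/-- Cap estimate at height `0.515 / √m`. -/
theorem integral_le_integral_tail (k : ℕ) (hk : 2 ≤ k) :
    9 / 20 * ∫ t in (0 : ℝ)..1, √(1 - t ^ 2) ^ k ≤
      ∫ t in (103 / 200 / √((k : ℝ) + 3))..1, √(1 - t ^ 2) ^ k := by
  have hk' : (2 : ℝ) ≤ k := by exact_mod_cast hk
  set s := √((k : ℝ) + 3) with hs
  have hs2 : s ^ 2 = k + 3 := Real.sq_sqrt (by positivity)
  have hs1 : 1 < s := by
    rw [hs, Real.lt_sqrt zero_le_one]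
    linarith
  set c := 103 / 200 / s with hc
  have hc0 : 0 ≤ c := by positivity
  have h1 := le_integral_sqrt_one_sub_sq_pow k hk
  have h2 : ∫ t in (0 : ℝ)..c, √(1 - t ^ 2) ^ k ≤ c := by
    have : ∫ t in (0 : ℝ)..c, √(1 - t ^ 2) ^ k ≤ ∫ t in (0 : ℝ)..c, (1 : ℝ) := by
      refine intervalIntegral.integral_mono_on hc0 (Continuous.intervalIntegrable (by fun_prop) _ _)
        (by simp) fun t ht => ?_
      refine pow_le_one₀ (by positivity) ?_
      rw [Real.sqrt_le_one]
      nlinarith [sq_nonneg t]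
    simpa using this
  -- The head is at most c, so it is enough that c is at most 11/20 of the lower bound for the whole
  -- integral.
  have h3 : c ≤ 11 / 20 * (2 / 3 * √(2 / k)) := by
    have h6 : 103 / 200 * (30 / 11) / s ≤ √(2 / k) := by
      refine Real.le_sqrt_of_sq_le ?_
      rw [div_pow, hs2, div_le_div_iff₀ (by linarith) (by linarith)]
      nlinarith
    have : c = 11 / 30 * (103 / 200 * (30 / 11) / s) := by rw [hc]; ring
    linarith
  have h5 := intervalIntegral.integral_add_adjacent_intervals (a := 0) (b := c) (c := 1)
    (f := fun t : ℝ => √(1 - t ^ 2) ^ k) (μ := MeasureTheory.volume)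
    (Continuous.intervalIntegrable (by fun_prop) _ _)
    (Continuous.intervalIntegrable (by fun_prop) _ _)
  linarith

/-! ### Volumes by slicing and the measure of a spherical cap -/

/-- A set of points of `ℝ^(d+1)` described by the first coordinate and the length of the vector of
the remaining coordinates is measured by slices. -/
theorem volume_setOf_head_tail {d : ℕ} (S : Set (ℝ × EuclideanSpace ℝ (Fin d)))
    (hS : MeasurableSet S) :
    volume {x : EuclideanSpace ℝ (Fin (d + 1)) | (x 0, WithLp.toLp 2 (fun i => x i.succ)) ∈ S} =
      ∫⁻ s : ℝ, volume {z | (s, z) ∈ S} := by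
  have h1 := PiLp.volume_preserving_ofLp (Fin (d + 1))
  have h2 := volume_preserving_piFinSuccAbove (fun _ : Fin (d + 1) => ℝ) 0
  have h3 := (MeasurePreserving.id (volume : Measure ℝ)).prod (PiLp.volume_preserving_toLp (Fin d))
  have h := h3.comp (h2.comp h1)
  rw [← Measure.volume_eq_prod] at h
  have := h.measure_preimage hS.nullMeasurableSet
  rw [Measure.volume_eq_prod, Measure.prod_apply hS] at this
  exact this

theorem norm_sq_eq_head_tail {d : ℕ} (x : EuclideanSpace ℝ (Fin (d + 1))) :
    ‖x‖ ^ 2 = x 0 ^ 2 + ‖(WithLp.toLp 2 (fun i => x i.succ) : EuclideanSpace ℝ (Fin d))‖ ^ 2 := by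
  simp [EuclideanSpace.norm_sq_eq, Fin.sum_univ_succ]

theorem volume_ball_eq_ofReal {d : ℕ} {r : ℝ} (hr : 0 < r) :
    volume (Metric.ball (0 : EuclideanSpace ℝ (Fin d)) r) =
      ENNReal.ofReal (r ^ d * volume.real (Metric.ball (0 : EuclideanSpace ℝ (Fin d)) 1)) := by
  rw [Measure.addHaar_ball_of_pos _ _ hr, ENNReal.ofReal_mul (by positivity), measureReal_def,
    ENNReal.ofReal_toReal measure_ball_lt_top.ne]
  simp

/-- The volume of a solid of revolution. -/
theorem volume_eq_integral_pow {d : ℕ} {a b : ℝ} (hab : a ≤ b)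
    (S : Set (ℝ × EuclideanSpace ℝ (Fin d))) (hS : MeasurableSet S) (ρ : ℝ → ℝ)
    (hρ : Continuous ρ) (hpos : ∀ s ∈ Set.Ioo a b, 0 < ρ s)
    (hslice : ∀ s ∈ Set.Ioo a b, ∀ z, (s, z) ∈ S ↔ ‖z‖ < ρ s)
    (hout : ∀ s ∉ Set.Ioo a b, ∀ z, (s, z) ∉ S) :
    volume.real {x : EuclideanSpace ℝ (Fin (d + 1)) |
        (x 0, WithLp.toLp 2 (fun i => x i.succ)) ∈ S} =
      (∫ s in a..b, ρ s ^ d) * volume.real (Metric.ball (0 : EuclideanSpace ℝ (Fin d)) 1) := by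
  set κ := volume.real (Metric.ball (0 : EuclideanSpace ℝ (Fin d)) 1) with hκ
  have hslice' : ∀ s, volume {z | (s, z) ∈ S} =
      (Set.Ioo a b).indicator (fun s => ENNReal.ofReal (ρ s ^ d * κ)) s := by
    intro s
    by_cases hs : s ∈ Set.Ioo a b
    · rw [Set.indicator_of_mem hs, ← volume_ball_eq_ofReal (hpos s hs)]
      congr 1
      ext z
      simp [hslice s hs z]
    · rw [Set.indicator_of_notMem hs]
      simp [hout s hs]
  have hint : IntegrableOn (fun s => ρ s ^ d * κ) (Set.Ioo a b) :=
    (Continuous.integrableOn_Icc (by fun_prop)).mono_set Set.Ioo_subset_Icc_self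
  rw [measureReal_def, volume_setOf_head_tail S hS, lintegral_congr hslice',
    lintegral_indicator measurableSet_Ioo, ← ofReal_integral_eq_lintegral_ofReal hint,
    ENNReal.toReal_ofReal, intervalIntegral.integral_of_le hab, integral_Ioc_eq_integral_Ioo,
    integral_mul_const]
  · refine setIntegral_nonneg measurableSet_Ioo fun s hs => ?_
    have := hpos s hs
    positivity
  · filter_upwards [ae_restrict_mem measurableSet_Ioo] with s hs
    have := hpos s hs
    show 0 ≤ ρ s ^ d * κ
    positivity

theorem volume_real_unit_ball_succ (d : ℕ) :
    volume.real (Metric.ball (0 : EuclideanSpace ℝ (Fin (d + 1))) 1) =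
      (2 * ∫ s in (0 : ℝ)..1, √(1 - s ^ 2) ^ d) *
        volume.real (Metric.ball (0 : EuclideanSpace ℝ (Fin d)) 1) := by
  have h := volume_eq_integral_pow (d := d) (a := -1) (b := 1) (by norm_num)
    {p | p.1 ^ 2 + ‖p.2‖ ^ 2 < 1} (measurableSet_lt (by fun_prop) (by fun_prop))
    (fun s => √(1 - s ^ 2)) (by fun_prop) (fun s hs => Real.sqrt_pos.2 (by nlinarith [hs.1, hs.2]))
    (fun s hs z => by
      rw [Real.lt_sqrt (norm_nonneg z), Set.mem_ofPred_eq, lt_sub_iff_add_lt']) (fun s hs z hz => by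
      have h1 : s ^ 2 < 1 := by
        have : s ^ 2 + ‖z‖ ^ 2 < 1 := hz
        nlinarith [sq_nonneg ‖z‖]
      exact hs (abs_lt.1 ((sq_lt_one_iff_abs_lt_one s).1 h1)))
  have hball : {x : EuclideanSpace ℝ (Fin (d + 1)) | (x 0, WithLp.toLp 2 (fun i => x i.succ)) ∈
      {p : ℝ × EuclideanSpace ℝ (Fin d) | p.1 ^ 2 + ‖p.2‖ ^ 2 < 1}} = Metric.ball 0 1 := by
    ext x
    rw [Set.mem_ofPred_eq, Set.mem_ofPred_eq, mem_ball_zero_iff, ← norm_sq_eq_head_tail,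
      sq_lt_one_iff₀ (norm_nonneg x)]
  rw [hball] at h
  rw [h, ← intervalIntegral.integral_add_adjacent_intervals (b := 0)
    (Continuous.intervalIntegrable (by fun_prop) _ _)
    (Continuous.intervalIntegrable (by fun_prop) _ _)]
  have h2 := intervalIntegral.integral_comp_neg (a := (0 : ℝ)) (b := 1)
    (fun s : ℝ => √(1 - s ^ 2) ^ d)
  simp only [neg_sq, neg_zero] at h2
  rw [← h2]
  ring

/-- The slice at height s is a ball whose radius is the smaller of the cone's and the unit ball's.
The conical part s < c integrates to the boundary term that integration by parts produces on c < s <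
1, and the two cancel. -/
theorem volume_real_cone (k : ℕ) {c : ℝ} (h0 : 0 < c) (h1 : c < 1) :
    ((k : ℝ) + 3) * volume.real {x : EuclideanSpace ℝ (Fin (k + 2 + 1)) | ‖x‖ < 1 ∧ c * ‖x‖ < x 0} =
      ((k : ℝ) + 2) * (∫ t in c..1, √(1 - t ^ 2) ^ k) *
        volume.real (Metric.ball (0 : EuclideanSpace ℝ (Fin (k + 2))) 1) := by
  have hc2 : 0 < 1 - c ^ 2 := by nlinarith
  have hσc : 0 < √(1 - c ^ 2) := Real.sqrt_pos.2 hc2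
  have hσc2 : √(1 - c ^ 2) ^ 2 = 1 - c ^ 2 := Real.sq_sqrt hc2.le
  have hm : MeasurableSet {p : ℝ × EuclideanSpace ℝ (Fin (k + 2)) |
      p.1 ^ 2 + ‖p.2‖ ^ 2 < 1 ∧ 0 < p.1 ∧ c ^ 2 * (p.1 ^ 2 + ‖p.2‖ ^ 2) < p.1 ^ 2} := by
    simp only [Set.ofPred_and]
    refine (measurableSet_lt ?_ ?_).inter ((measurableSet_lt ?_ ?_).inter
      (measurableSet_lt ?_ ?_)) <;> fun_prop
  have h := volume_eq_integral_pow (d := k + 2) (a := 0) (b := 1) zero_le_one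
    {p | p.1 ^ 2 + ‖p.2‖ ^ 2 < 1 ∧ 0 < p.1 ∧ c ^ 2 * (p.1 ^ 2 + ‖p.2‖ ^ 2) < p.1 ^ 2}
    hm
    (fun s => min (√(1 - c ^ 2) / c * s) √(1 - s ^ 2)) (by fun_prop)
    (fun s hs => lt_min (mul_pos (by positivity) hs.1)
      (Real.sqrt_pos.2 (by nlinarith [hs.1, hs.2])))
    (fun s hs z => by
      have hs0 : 0 < s := hs.1
      rw [lt_min_iff, Real.lt_sqrt (norm_nonneg z), Set.mem_ofPred_eq]
      have e : ‖z‖ < √(1 - c ^ 2) / c * s ↔ c ^ 2 * (s ^ 2 + ‖z‖ ^ 2) < s ^ 2 := by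
        rw [← sq_lt_sq₀ (norm_nonneg z) (by positivity), mul_pow, div_pow, hσc2,
          div_mul_eq_mul_div, lt_div_iff₀ (by positivity)]
        constructor <;> intro h <;> linarith
      rw [e]
      constructor
      · rintro ⟨h2, h3, h4⟩
        exact ⟨h4, by linarith⟩
      · rintro ⟨h2, h3⟩
        exact ⟨by linarith, hs0, h2⟩)
    (fun s hs z hz => by
      obtain ⟨h2, h3, h4⟩ := hz
      simp only at h2 h3 h4
      exact hs ⟨h3, by nlinarith [sq_nonneg ‖z‖]⟩)
  have hset : {x : EuclideanSpace ℝ (Fin (k + 2 + 1)) | (x 0, WithLp.toLp 2 (fun i => x i.succ)) ∈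
      {p : ℝ × EuclideanSpace ℝ (Fin (k + 2)) | p.1 ^ 2 + ‖p.2‖ ^ 2 < 1 ∧ 0 < p.1 ∧
        c ^ 2 * (p.1 ^ 2 + ‖p.2‖ ^ 2) < p.1 ^ 2}} = {x | ‖x‖ < 1 ∧ c * ‖x‖ < x 0} := by
    ext x
    simp only [Set.mem_ofPred_eq, ← norm_sq_eq_head_tail, sq_lt_one_iff₀ (norm_nonneg x)]
    refine and_congr_right fun _ => ⟨fun ⟨h2, h3⟩ => ?_, fun h2 => ?_⟩
    · rw [← mul_pow] at h3
      exact (sq_lt_sq₀ (by positivity) h2.le).1 h3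
    · have h3 : 0 < x 0 := lt_of_le_of_lt (by positivity) h2
      refine ⟨h3, ?_⟩
      rw [← mul_pow]
      exact (sq_lt_sq₀ (by positivity) h3.le).2 h2
  rw [hset] at h
  rw [h, ← mul_assoc]
  congr 1
  rw [← intervalIntegral.integral_add_adjacent_intervals (b := c)
    (Continuous.intervalIntegrable (by fun_prop) _ _)
    (Continuous.intervalIntegrable (by fun_prop) _ _)]
  -- The two radii cross exactly at s = c.
  have cmp : ∀ s, 0 ≤ s → s ≤ 1 → (√(1 - c ^ 2) / c * s ≤ √(1 - s ^ 2) ↔ s ≤ c) := by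
    intro s hs0 hs1
    rw [Real.le_sqrt (by positivity), mul_pow, div_pow, hσc2, div_mul_eq_mul_div,
      div_le_iff₀ (by positivity), ← sq_le_sq₀ hs0 h0.le]
    · constructor <;> intro h <;> linarith
    · nlinarith
  have i1 : ∫ s in (0 : ℝ)..c, min (√(1 - c ^ 2) / c * s) √(1 - s ^ 2) ^ (k + 2) =
      c * √(1 - c ^ 2) ^ (k + 2) / ((k : ℝ) + 3) := by
    rw [intervalIntegral.integral_congr (g := fun s => (√(1 - c ^ 2) / c) ^ (k + 2) * s ^ (k + 2))]
    · rw [intervalIntegral.integral_const_mul, integral_pow]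
      have : c ^ (k + 2 + 1) = c ^ (k + 2) * c := pow_succ _ _
      simp only [div_pow]
      rw [this]
      push_cast
      field_simp
      ring
    · intro s hs
      rw [Set.uIcc_of_le h0.le] at hs
      simp only
      rw [min_eq_left ((cmp s hs.1 (hs.2.trans h1.le)).2 hs.2), mul_pow]
  have i2 : ∫ s in c..1, min (√(1 - c ^ 2) / c * s) √(1 - s ^ 2) ^ (k + 2) =
      ∫ s in c..1, √(1 - s ^ 2) ^ (k + 2) := by
    refine intervalIntegral.integral_congr fun s hs => ?_
    rw [Set.uIcc_of_le h1.le] at hs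
    congr 1
    rcases hs.1.eq_or_lt with rfl | hlt
    · rw [min_eq_right]
      field_simp
      rfl
    · refine min_eq_right (le_of_not_ge fun hle => ?_)
      exact absurd ((cmp s (h0.le.trans hs.1) hs.2).1 hle) (not_le.2 hlt)
  rw [i1, i2, mul_add, integral_sqrt_one_sub_sq_pow_add_two k h0.le h1.le]
  field_simp
  ring

theorem exists_frame_of_norm_eq_one {d : ℕ} (e : EuclideanSpace ℝ (Fin (d + 1))) (he : ‖e‖ = 1) :
    ∃ Q : EuclideanSpace ℝ (Fin (d + 1)) ≃ₗᵢ[ℝ] EuclideanSpace ℝ (Fin (d + 1)),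
      ∀ x, ⟪e, Q x⟫ = x 0 := by
  obtain ⟨Q, hQ⟩ := exists_frame e he
  refine ⟨Q, fun x => ?_⟩
  rw [← hQ, Q.inner_map_map, EuclideanSpace.inner_single_left]
  simp

/-- The uniform measure of a spherical cap. -/
theorem uniformSphere_cap (k : ℕ) {c : ℝ} (h0 : 0 < c) (h1 : c < 1)
    (e : EuclideanSpace ℝ (Fin (k + 2 + 1))) (he : ‖e‖ = 1) :
    (uniformSphere (k + 2 + 1)).real {y | c < ⟪e, y.1⟫} * (2 * ∫ t in (0 : ℝ)..1, √(1 - t ^ 2) ^ k) =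
      ∫ t in c..1, √(1 - t ^ 2) ^ k := by
  obtain ⟨Q, hQ⟩ := exists_frame_of_norm_eq_one e he
  have hmeas : MeasurableSet {y : UnitSphere (k + 2 + 1) | c < ⟪e, y.1⟫} :=
    measurableSet_lt (by fun_prop) (by fun_prop)
  -- The surface measure of a set is the dimension times the volume of the cone over it, and a
  -- rotation moves the axis of this cone to the first coordinate.
  have hcone : Set.Ioo (0 : ℝ) 1 • ((↑) '' {y : UnitSphere (k + 2 + 1) | c < ⟪e, y.1⟫} :
      Set (EuclideanSpace ℝ (Fin (k + 2 + 1)))) =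
      Q.symm ⁻¹' {x : EuclideanSpace ℝ (Fin (k + 2 + 1)) | ‖x‖ < 1 ∧ c * ‖x‖ < x 0} := by
    ext x
    simp only [Set.mem_smul, Set.mem_image, Set.mem_preimage, Set.mem_ofPred_eq, Q.symm.norm_map]
    rw [← hQ, Q.apply_symm_apply]
    constructor
    · rintro ⟨t, ht, _, ⟨y, hy, rfl⟩, rfl⟩
      have hyn : ‖y.1‖ = 1 := by simp
      rw [norm_smul, hyn, mul_one, Real.norm_of_nonneg ht.1.le, inner_smul_right]
      exact ⟨ht.2, by nlinarith [ht.1]⟩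
    · rintro ⟨hx1, hx2⟩
      have hx0 : 0 < ‖x‖ := by
        rw [norm_pos_iff]
        rintro rfl
        simp at hx2
      refine ⟨‖x‖, ⟨hx0, hx1⟩, ‖x‖⁻¹ • x, ⟨⟨‖x‖⁻¹ • x, ?_⟩, ?_, rfl⟩, ?_⟩
      · simp [norm_smul, hx0.ne']
      · simp only [inner_smul_right]
        rw [inv_mul_eq_div, lt_div_iff₀ hx0]
        exact hx2
      · rw [smul_smul, mul_inv_cancel₀ hx0.ne', one_smul]
  have hvol := Q.symm.measurePreserving.measure_preimage_equiv (f := Q.symm.toMeasurableEquiv)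
    {x : EuclideanSpace ℝ (Fin (k + 2 + 1)) | ‖x‖ < 1 ∧ c * ‖x‖ < x 0}
  have hreal : (uniformSphere (k + 2 + 1)).real {y | c < ⟪e, y.1⟫} *
      volume.real (Metric.ball (0 : EuclideanSpace ℝ (Fin (k + 2 + 1))) 1) =
      volume.real {x : EuclideanSpace ℝ (Fin (k + 2 + 1)) | ‖x‖ < 1 ∧ c * ‖x‖ < x 0} := by
    rw [uniformSphere, measureReal_ennreal_smul_apply, ENNReal.toReal_inv, ← measureReal_def,
      Measure.toSphere_real_apply_univ, measureReal_def (Measure.toSphere _),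
      Measure.toSphere_apply' _ hmeas, hcone, ENNReal.toReal_mul]
    have : volume.real (Metric.ball (0 : EuclideanSpace ℝ (Fin (k + 2 + 1))) 1) ≠ 0 :=
      (ENNReal.toReal_pos (Metric.measure_ball_pos _ _ one_pos).ne' measure_ball_lt_top.ne).ne'
    simp only [finrank_euclideanSpace, Fintype.card_fin, ENNReal.toReal_natCast]
    have h3 : ((k + 2 + 1 : ℕ) : ℝ) ≠ 0 := by positivity
    rw [show volume (Q.symm ⁻¹' _) = _ from hvol, ← measureReal_def]
    generalize volume.real {x : EuclideanSpace ℝ (Fin (k + 2 + 1)) | ‖x‖ < 1 ∧ c * ‖x‖ < x 0} = V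
    field_simp
  have hκ : volume.real (Metric.ball (0 : EuclideanSpace ℝ (Fin (k + 2))) 1) ≠ 0 :=
      (ENNReal.toReal_pos (Metric.measure_ball_pos _ _ one_pos).ne' measure_ball_lt_top.ne).ne'
  have hcv := volume_real_cone k h0 h1
  rw [← hreal, volume_real_unit_ball_succ] at hcv
  have hJ := integral_sqrt_one_sub_sq_pow_add_two k le_rfl zero_le_one
  have hk : (k : ℝ) + 2 ≠ 0 := by positivity
  refine mul_left_cancel₀ hk (mul_right_cancel₀ hκ ?_)
  rw [← hcv]
  rw [zero_mul, sub_zero] at hJ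
  linear_combination (-2) * ((uniformSphere (k + 2 + 1)).real {y | c < ⟪e, y.1⟫}) *
    volume.real (Metric.ball (0 : EuclideanSpace ℝ (Fin (k + 2))) 1) * hJ

/-! ### Concentration of the sampled frequency -/

/-- Hoeffding's inequality for the empirical frequency of an event. -/
theorem measureReal_pi_frequency_ge_le {Ω : Type*} [MeasurableSpace Ω] (μ : Measure Ω)
    [IsProbabilityMeasure μ] (T : ℕ) {S : Set Ω} (hS : MeasurableSet S) {s : ℝ} (hs : 0 ≤ s) :
    (Measure.pi fun _ : Fin T => μ).real
      {ys | T * (μ.real S + s) ≤ ∑ i, S.indicator (fun _ => (1 : ℝ)) (ys i)} ≤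
      Real.exp (-2 * T * s ^ 2) := by
  rcases Nat.eq_zero_or_pos T with rfl | hT
  · simp
  have hT' : (0 : ℝ) < T := by exact_mod_cast hT
  set X : Ω → ℝ := fun y => S.indicator (fun _ => (1 : ℝ)) y - μ.real S with hX
  have hXm : Measurable X := (measurable_const.indicator hS).sub_const _
  -- A centred indicator has sub-Gaussian parameter 1/4, whence the exponent -2Ts².
  have hsub : HasSubgaussianMGF X ((‖(1 : ℝ) - 0‖₊ / 2) ^ 2) μ := by
    have h := hasSubgaussianMGF_of_mem_Icc (μ := μ) (X := S.indicator fun _ => (1 : ℝ))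
      (a := 0) (b := 1) (measurable_const.indicator hS).aemeasurable
      (Filter.Eventually.of_forall fun y => by
        by_cases hy : y ∈ S <;> simp [hy])
    rw [integral_indicator_const _ hS, smul_eq_mul, mul_one] at h
    exact h
  have hind : iIndepFun (fun (i : Fin T) (ys : Fin T → Ω) => X (ys i))
      (Measure.pi fun _ : Fin T => μ) := iIndepFun_pi fun _ => hXm.aemeasurable
  have hsubi : ∀ i ∈ (Finset.univ : Finset (Fin T)),
      HasSubgaussianMGF (fun ys : Fin T → Ω => X (ys i)) ((‖(1 : ℝ) - 0‖₊ / 2) ^ 2)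
        (Measure.pi fun _ : Fin T => μ) := by
    intro i _
    refine HasSubgaussianMGF.of_map (X := X) (Y := fun ys : Fin T → Ω => ys i)
      (measurable_pi_apply i).aemeasurable ?_
    rw [(measurePreserving_eval (fun _ : Fin T => μ) i).map_eq]
    exact hsub
  have key := HasSubgaussianMGF.measure_sum_ge_le_of_iIndepFun hind hsubi (ε := T * s)
    (by positivity)
  have hset : {ys : Fin T → Ω | T * (μ.real S + s) ≤ ∑ i, S.indicator (fun _ => (1 : ℝ)) (ys i)} =
      {ys | T * s ≤ ∑ i, X (ys i)} := by
    ext ys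
    simp only [hX, Set.mem_ofPred_eq, Finset.sum_sub_distrib, Finset.sum_const, Finset.card_univ,
      Fintype.card_fin, nsmul_eq_mul]
    constructor <;> intro h <;> linarith
  rw [hset]
  refine key.trans (Real.exp_le_exp.2 (le_of_eq ?_))
  simp
  field_simp

theorem measureReal_pi_frequency_le_le {Ω : Type*} [MeasurableSpace Ω] (μ : Measure Ω)
    [IsProbabilityMeasure μ] (T : ℕ) {S : Set Ω} (hS : MeasurableSet S) {s : ℝ} (hs : 0 ≤ s) :
    (Measure.pi fun _ : Fin T => μ).real
      {ys | ∑ i, S.indicator (fun _ => (1 : ℝ)) (ys i) ≤ T * (μ.real S - s)} ≤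
      Real.exp (-2 * T * s ^ 2) := by
  have h := measureReal_pi_frequency_ge_le μ T hS.compl hs
  convert h using 3
  ext ys
  have : ∀ y, Sᶜ.indicator (fun _ => (1 : ℝ)) y = 1 - S.indicator (fun _ => (1 : ℝ)) y := by
    intro y
    by_cases hy : y ∈ S <;> simp [hy]
  simp only [this, probReal_compl_eq_one_sub hS, Finset.sum_sub_distrib, Finset.sum_const,
    Finset.card_univ, Fintype.card_fin, nsmul_eq_mul]
  constructor <;> intro h <;> linarith

theorem testRounds_pos : 0 < testRounds := by
  rw [testRounds, Nat.ceil_pos]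
  have : 0 < Real.log (1 / (1 / 3 : ℝ)) := Real.log_pos (by norm_num)
  positivity

/-- The factor 3200 in the number of rounds is 1/(2·(1/80)²). -/
theorem exp_testRounds_le : Real.exp (-2 * testRounds * (1 / 80) ^ 2) ≤ 1 / 3 := by
  have h : 3200 * Real.log (1 / (1 / 3 : ℝ)) ≤ testRounds := Nat.le_ceil _
  rw [one_div_one_div] at h
  calc _ ≤ Real.exp (-Real.log 3) := Real.exp_le_exp.2 (by linarith)
    _ = 1 / 3 := by rw [Real.exp_neg, Real.exp_log (by norm_num), one_div]

theorem two_thirds_le_of_compl_le {Ω : Type*} [MeasurableSpace Ω] (μ : Measure Ω)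
    [IsProbabilityMeasure μ] {S : Set Ω} (hS : MeasurableSet S) (h : μ.real Sᶜ ≤ 1 / 3) :
    2 / 3 ≤ μ S := by
  rw [probReal_compl_eq_one_sub hS] at h
  have h1 : (2 / 3 : ℝ) ≤ μ.real S := by linarith
  have h2 : (2 / 3 : ENNReal) = ENNReal.ofReal (2 / 3) := by
    rw [ENNReal.ofReal_div_of_pos (by norm_num)]
    simp
  rw [h2, ENNReal.ofReal_le_iff_le_toReal (measure_ne_top _ _)]
  exact h1

theorem measurableSet_frequency_le {Ω : Type*} [MeasurableSpace Ω] {T : ℕ} {S : Set Ω}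
    (hS : MeasurableSet S) (q : ℝ) :
    MeasurableSet {ys : Fin T → Ω | q ≤ ∑ i, S.indicator (fun _ => (1 : ℝ)) (ys i)} := by
  refine measurableSet_le measurable_const (Finset.measurable_sum _ fun i _ => ?_)
  exact (measurable_const.indicator hS).comp (measurable_pi_apply i)

/-- An event of probability at least `4/5` has sampled frequency at least `63/80`. -/
theorem two_thirds_le_sampleLaw_frequency_ge {m : ℕ} [IsProbabilityMeasure (uniformSphere m)]
    {S : Set (UnitSphere m)} (hS : MeasurableSet S) (hp : 4 / 5 ≤ (uniformSphere m).real S) :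
    2 / 3 ≤ sampleLaw m
      {ys | 63 / 80 * testRounds ≤ ∑ i, S.indicator (fun _ => (1 : ℝ)) (ys i)} := by
  have : IsProbabilityMeasure (sampleLaw m) := by unfold sampleLaw; infer_instance
  refine two_thirds_le_of_compl_le _ (measurableSet_frequency_le hS _) ?_
  refine (measureReal_mono fun ys hys => ?_).trans
    ((measureReal_pi_frequency_le_le (uniformSphere m) testRounds hS
      (s := 1 / 80) (by norm_num)).trans exp_testRounds_le)
  simp only [Set.mem_compl_iff, Set.mem_ofPred_eq, not_le] at hys ⊢
  nlinarith [Nat.cast_nonneg (α := ℝ) testRounds]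

/-- An event of probability at most `31/40` has sampled frequency below `63/80`. -/
theorem two_thirds_le_sampleLaw_frequency_lt {m : ℕ} [IsProbabilityMeasure (uniformSphere m)]
    {S : Set (UnitSphere m)} (hS : MeasurableSet S) (hp : (uniformSphere m).real S ≤ 31 / 40) :
    2 / 3 ≤ sampleLaw m
      {ys | 63 / 80 * testRounds ≤ ∑ i, S.indicator (fun _ => (1 : ℝ)) (ys i)}ᶜ := by
  have : IsProbabilityMeasure (sampleLaw m) := by unfold sampleLaw; infer_instance
  refine two_thirds_le_of_compl_le _ (measurableSet_frequency_le hS _).compl ?_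
  rw [compl_compl]
  refine (measureReal_mono fun ys hys => ?_).trans
    ((measureReal_pi_frequency_ge_le (uniformSphere m) testRounds hS
      (s := 1 / 80) (by norm_num)).trans exp_testRounds_le)
  simp only [Set.mem_ofPred_eq] at hys ⊢
  nlinarith [Nat.cast_nonneg (α := ℝ) testRounds]

/-! ### Numerical cap probabilities -/

theorem integral_sqrt_one_sub_sq_pow_pos (k : ℕ) (hk : 2 ≤ k) :
    0 < ∫ t in (0 : ℝ)..1, √(1 - t ^ 2) ^ k := by
  have hk' : (0 : ℝ) < k := by exact_mod_cast (by omega : 0 < k)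
  refine lt_of_lt_of_le ?_ (le_integral_sqrt_one_sub_sq_pow k hk)
  positivity

theorem const_div_sqrt_mem {m : ℕ} (hm : 5 ≤ m) {q : ℝ} (h0 : 0 < q) (h1 : q < 1) :
    0 < q / √(m : ℝ) ∧ q / √(m : ℝ) < 1 := by
  have hm' : (5 : ℝ) ≤ m := by exact_mod_cast hm
  have hs : 1 < √(m : ℝ) := by
    rw [Real.lt_sqrt zero_le_one]
    linarith
  exact ⟨by positivity, by rw [div_lt_one (by linarith)]; linarith⟩

/-- Half of the ratio 2/5 of one-sided integrals, since the sphere has two sides; m = k + 3, so m ≥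
5 is k ≥ 2. -/
theorem uniformSphere_cap_le {m : ℕ} (hm : 5 ≤ m) (e : EuclideanSpace ℝ (Fin m)) (he : ‖e‖ = 1) :
    (uniformSphere m).real {y | 49 / 50 / √(m : ℝ) < ⟪e, y.1⟫} ≤ 1 / 5 := by
  obtain ⟨h0, h1⟩ := const_div_sqrt_mem hm (q := 49 / 50) (by norm_num) (by norm_num)
  obtain ⟨k, rfl⟩ : ∃ k, m = k + 2 + 1 := ⟨m - 3, by omega⟩
  have hI := integral_sqrt_one_sub_sq_pow_pos k (by omega)
  have h2 := uniformSphere_cap k h0 h1 e he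
  have h3 := integral_tail_le_integral k (by omega)
  rw [show (k : ℝ) + 3 = ((k + 2 + 1 : ℕ) : ℝ) by push_cast; ring] at h3
  nlinarith

theorem le_uniformSphere_cap {m : ℕ} (hm : 5 ≤ m) (e : EuclideanSpace ℝ (Fin m)) (he : ‖e‖ = 1) :
    9 / 40 ≤ (uniformSphere m).real {y | 103 / 200 / √(m : ℝ) < ⟪e, y.1⟫} := by
  obtain ⟨h0, h1⟩ := const_div_sqrt_mem hm (q := 103 / 200) (by norm_num) (by norm_num)
  obtain ⟨k, rfl⟩ : ∃ k, m = k + 2 + 1 := ⟨m - 3, by omega⟩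
  have hI := integral_sqrt_one_sub_sq_pow_pos k (by omega)
  have h2 := uniformSphere_cap k h0 h1 e he
  have h3 := integral_le_integral_tail k (by omega)
  rw [show (k : ℝ) + 3 = ((k + 2 + 1 : ℕ) : ℝ) by push_cast; ring] at h3
  nlinarith

/-! ### The test vector in the close and far cases -/

theorem inner_testVector {m : ℕ} (ε : ℝ) (h : EuclideanSpace ℝ (Fin (m + 1))) (y : UnitSphere m) :
    ⟪h, testVector ε y⟫ = -(ε / √((m : ℝ) * (1 - ε ^ 2))) * h 0 +
      ⟪(WithLp.toLp 2 (fun i => h i.succ) : EuclideanSpace ℝ (Fin m)), y.1⟫ := by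
  simp only [testVector, PiLp.inner_apply, Fin.sum_univ_succ, Fin.cons_zero, Fin.cons_succ]
  simp [neg_div]

theorem norm_testVector {m : ℕ} (ε : ℝ) (y : UnitSphere m) :
    ‖testVector ε y‖ = √((ε / √((m : ℝ) * (1 - ε ^ 2))) ^ 2 + 1) := by
  have hy : ‖y.1‖ = 1 := by simp
  rw [← Real.sqrt_sq (norm_nonneg (testVector ε y)), norm_sq_eq_head_tail]
  simp only [testVector, Fin.cons_zero, Fin.cons_succ]
  rw [show (WithLp.toLp 2 fun i => y.1 i : EuclideanSpace ℝ (Fin m)) = y.1 from rfl, hy]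
  simp [neg_div]

/-- The rounding error of directional preference, measured at the scale `ε / √m`. -/
theorem preference_error_le {m ε : ℝ} (hm : 5 ≤ m) (h0 : 0 < ε) (h1 : ε ^ 2 < 1 / 2) :
    ε * √((ε / √(m * (1 - ε ^ 2))) ^ 2 + 1) / (25 * √2 * (m + 1)) ≤ ε / (64 * √m) := by
  have hs : 0 < √m := Real.sqrt_pos.2 (by linarith)
  have hs2 : √m ^ 2 = m := Real.sq_sqrt (by linarith)
  have hA : √((ε / √(m * (1 - ε ^ 2))) ^ 2 + 1) ≤ 11 / 10 := by
    rw [Real.sqrt_le_left (by norm_num), div_pow, Real.sq_sqrt (by nlinarith)]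
    have : ε ^ 2 / (m * (1 - ε ^ 2)) ≤ 1 / 5 := by
      rw [div_le_div_iff₀ (by nlinarith) (by norm_num)]
      nlinarith
    linarith
  -- Chosen so that 2·25·(704/500) = 64·(11/10).
  have h2 : (704 / 500 : ℝ) ≤ √2 := Real.le_sqrt_of_sq_le (by norm_num)
  have h3 : 2 * √m ≤ m + 1 := by nlinarith [sq_nonneg (√m - 1)]
  rw [div_le_div_iff₀ (by positivity) (by positivity), mul_assoc]
  refine mul_le_mul_of_nonneg_left ?_ h0.le
  calc _ ≤ 11 / 10 * (64 * √m) := mul_le_mul_of_nonneg_right hA (by positivity)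
    _ = 25 * (704 / 500) * (2 * √m) := by ring
    _ ≤ 25 * √2 * (m + 1) := by gcongr

/-- Since g ≥ 1 - ε²/2 ≥ √(1-ε²) and W ≤ ε, the left side is at most -(1/50)ε/√m, and 1/50 > 1/64.
-/
theorem inner_bound_of_close {m ε g W : ℝ} (hm : 5 ≤ m) (h0 : 0 < ε) (h1 : ε ^ 2 < 1 / 2)
    (hW : 0 ≤ W) (hgW : g ^ 2 + W ^ 2 = 1) (hg : 2 - 2 * g ≤ ε ^ 2) :
    -(ε / √(m * (1 - ε ^ 2))) * g + 49 / 50 / √m * W < -(ε / (64 * √m)) := by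
  have hs : 0 < √m := Real.sqrt_pos.2 (by linarith)
  rw [Real.sqrt_mul (by linarith)]
  set τ := √(1 - ε ^ 2)
  have hτ : 0 < τ := Real.sqrt_pos.2 (by linarith)
  have hτ2 : τ ^ 2 = 1 - ε ^ 2 := Real.sq_sqrt (by linarith)
  have hgτ : τ ≤ g := by nlinarith [sq_nonneg (τ - 1)]
  have hWε : W ≤ ε := by
    refine (sq_le_sq₀ hW h0.le).1 ?_
    nlinarith
  have h2 : ε / √m ≤ ε / (√m * τ) * g := by
    rw [div_mul_eq_mul_div, div_le_div_iff₀ hs (by positivity)]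
    have := mul_le_mul_of_nonneg_left hgτ (mul_pos h0 hs).le
    linarith
  have h3 : 49 / 50 / √m * W ≤ 49 / 50 * (ε / √m) := by
    calc _ ≤ 49 / 50 / √m * ε := mul_le_mul_of_nonneg_left hWε (by positivity)
      _ = _ := by ring
  have h4 : ε / (64 * √m) = 1 / 64 * (ε / √m) := by ring
  have h5 : 0 < ε / √m := by positivity
  rw [h4]
  linarith

/-- For g ≥ 0, the bound g < 1 - 2ε² gives W ≥ 2ε√(1-ε²). After multiplication by √(m(1-ε²)) the
right side is at least ε(0.03 + 0.97ε²), and 0.03 > 1/64. For g < 0 both terms are nonnegative and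
one of them is large. -/
theorem inner_bound_of_far {m ε g W : ℝ} (hm : 5 ≤ m) (h0 : 0 < ε) (h1 : ε ^ 2 < 1 / 2)
    (hW : 0 ≤ W) (hgW : g ^ 2 + W ^ 2 = 1) (hg : 4 * ε ^ 2 < 2 - 2 * g) :
    ε / (64 * √m) < -(ε / √(m * (1 - ε ^ 2))) * g + 103 / 200 / √m * W := by
  have hs : 0 < √m := Real.sqrt_pos.2 (by linarith)
  rw [Real.sqrt_mul (by linarith)]
  set τ := √(1 - ε ^ 2)
  have hτ : 0 < τ := Real.sqrt_pos.2 (by linarith)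
  have hτ2 : τ ^ 2 = 1 - ε ^ 2 := Real.sq_sqrt (by linarith)
  have hτ1 : τ ≤ 1 := by nlinarith
  have hε1 : ε < 1 := by nlinarith
  suffices h : ε / 64 * τ < -ε * g + 103 / 200 * W * τ by
    have h2 : ε / (64 * √m) = ε / 64 * τ / (√m * τ) := by field_simp
    have h3 : -(ε / (√m * τ)) * g + 103 / 200 / √m * W =
        (-ε * g + 103 / 200 * W * τ) / (√m * τ) := by field_simp
    rw [h2, h3]
    exact div_lt_div_of_pos_right h (by positivity)
  have hετ : ε * τ ≤ ε := by nlinarith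
  rcases le_or_gt 0 g with hg0 | hg0
  · have hW2 : 2 * ε * τ ≤ W := by
      refine (sq_le_sq₀ (by positivity) hW).1 ?_
      rw [mul_pow, hτ2]
      nlinarith
    have h5 : 2 * ε * (1 - ε ^ 2) ≤ W * τ := by
      rw [← hτ2]
      nlinarith
    have h6 : ε * g ≤ ε * (1 - 2 * ε ^ 2) := mul_le_mul_of_nonneg_left (by linarith) h0.le
    nlinarith [mul_pos h0 (mul_pos h0 h0)]
  · rcases le_or_gt g (-1 / 2) with hg1 | hg1
    · have : 0 ≤ W * τ := by positivity
      nlinarith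
    · have hW2 : 1 / 2 ≤ W := by nlinarith
      nlinarith [mul_pos h0 (neg_pos.2 hg0)]

theorem exists_unit_eq_norm_smul {m : ℕ} (hm : 0 < m) (w : EuclideanSpace ℝ (Fin m)) :
    ∃ e : EuclideanSpace ℝ (Fin m), ‖e‖ = 1 ∧ w = ‖w‖ • e := by
  rcases eq_or_ne w 0 with rfl | hw
  · exact ⟨EuclideanSpace.single ⟨0, hm⟩ 1, by simp, by simp⟩
  · have := norm_ne_zero_iff.2 hw
    exact ⟨‖w‖⁻¹ • w, by simp [norm_smul, this], by rw [smul_smul, mul_inv_cancel₀ this, one_smul]⟩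

theorem mainTheorem3 :
    ∃ C : ℕ, ∀ (m : ℕ), 5 ≤ m →
      ∀ (L ε γ : ℝ), 0 < L → 0 < ε → ε < 1 / √2 → 0 < γ →
      ∀ (f : EuclideanSpace ℝ (Fin (m + 1)) → ℝ), IsLSmooth L f →
      ∀ (O : EuclideanSpace ℝ (Fin (m + 1)) → EuclideanSpace ℝ (Fin (m + 1)) → ℤˣ),
        IsComparisonOracle f O →
      ∀ (x v : EuclideanSpace ℝ (Fin (m + 1)))
        (Q : EuclideanSpace ℝ (Fin (m + 1)) ≃ₗᵢ[ℝ] EuclideanSpace ℝ (Fin (m + 1))),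
        ‖v‖ = 1 → Q (EuclideanSpace.single 0 1) = v →
        γ ≤ ‖gradient f x‖ →
        (‖normalizedGradient f x - v‖ ≤ ε ∨ 2 * ε < ‖normalizedGradient f x - v‖) →
        (∀ ys : Fin testRounds → UnitSphere m,
          (gradientTest L ε γ x Q ys).queryCount O ≤ C) ∧
        ∃ E : Set (Fin testRounds → UnitSphere m),
          MeasurableSet E ∧ 2 / 3 ≤ sampleLaw m E ∧
          ∀ ys ∈ E, IsCorrectAnswer ε (normalizedGradient f x) v
            ((gradientTest L ε γ x Q ys).run O) := by
  refine ⟨testRounds, fun m hm L ε γ hL hε hε2 hγ f hf O hO x v Q hv hQv hγf hpromise =>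
    ⟨fun ys => (queryCount_gradientTest L ε γ x Q O ys).le, ?_⟩⟩
  have hm' : (5 : ℝ) ≤ m := by exact_mod_cast hm
  have hprob := isProbabilityMeasure_uniformSphere (m := m) (by omega)
  have hεsq : ε ^ 2 < 1 / 2 := by
    have h2 : (√2) ^ 2 = 2 := Real.sq_sqrt (by norm_num)
    rw [lt_div_iff₀ (by positivity)] at hε2
    have : (ε * √2) ^ 2 < 1 := (sq_lt_one_iff₀ (by positivity)).2 hε2
    rw [mul_pow, h2] at this
    linarith
  have hT : (0 : ℝ) < testRounds := by exact_mod_cast testRounds_pos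
  set Γ := ‖gradient f x‖ with hΓ
  have hΓ0 : 0 < Γ := hγ.trans_le hγf
  set g := normalizedGradient f x with hg
  have hgrad : gradient f x = Γ • g := by
    rw [hg, normalizedGradient, smul_smul, mul_inv_cancel₀ hΓ0.ne', one_smul]
  have hgn : ‖g‖ = 1 := by
    rw [hg, normalizedGradient, norm_smul, norm_inv, norm_norm, inv_mul_cancel₀ hΓ0.ne']
  set h := Q.symm g with hh
  set w : EuclideanSpace ℝ (Fin m) := WithLp.toLp 2 (fun i => h i.succ) with hw
  have hgw : h 0 ^ 2 + ‖w‖ ^ 2 = 1 := by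
    rw [← norm_sq_eq_head_tail, hh, Q.symm.norm_map, hgn, one_pow]
  have hdist : ‖g - v‖ ^ 2 = 2 - 2 * h 0 := by
    have h1 : ⟪g, v⟫ = h 0 := by
      rw [← hQv, ← Q.apply_symm_apply g, Q.inner_map_map, EuclideanSpace.inner_single_right]
      simp [hh]
    rw [norm_sub_sq_real, hgn, hv, h1]
    ring
  set a := ε / √((m : ℝ) * (1 - ε ^ 2)) with ha
  set A := √(a ^ 2 + 1) with hA
  have hA0 : 0 < A := Real.sqrt_pos.2 (by positivity)
  set Δ := ε * γ / (25 * √2 * ((m : ℝ) + 1)) with hΔ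
  have hΔ0 : 0 < Δ := by positivity
  set u : UnitSphere m → EuclideanSpace ℝ (Fin (m + 1)) := fun y =>
    Q (‖testVector ε y‖⁻¹ • testVector ε y) with hu
  have hun (y) : ‖u y‖ = 1 := by
    have : ‖testVector ε y‖ ≠ 0 := by rw [norm_testVector]; exact hA0.ne'
    rw [hu, Q.norm_map, norm_smul, norm_inv, norm_norm, inv_mul_cancel₀ this]
  have hinner (y) : ⟪gradient f x, u y⟫ = Γ / A * (-a * h 0 + ⟪w, y.1⟫) := by
    rw [hgrad, ← Q.apply_symm_apply g, hu, inner_smul_left, Q.inner_map_map, inner_smul_right,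
      inner_testVector, norm_testVector]
    simp only [conj_trivial]
    rw [div_eq_mul_inv Γ A, mul_assoc]
  have hmeas : Measurable fun y => ⟪gradient f x, u y⟫ := by
    simp only [hinner]
    fun_prop
  -- Normalizing the test vector and the gradient rescales inner products by Γ/A; γ ≤ Γ keeps Δ
  -- below the margin.
  have hΔA : Δ ≤ Γ / A * (ε / (64 * √m)) := by
    have h1 := preference_error_le hm' hε hεsq
    have h2 : Δ ≤ Γ / A * (ε * A / (25 * √2 * ((m : ℝ) + 1))) := by
      have h3 : Γ / A * (ε * A / (25 * √2 * ((m : ℝ) + 1))) =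
          ε * Γ / (25 * √2 * ((m : ℝ) + 1)) := by
        field_simp
      rw [h3, hΔ]
      gcongr
    exact h2.trans (mul_le_mul_of_nonneg_left h1 (by positivity))
  -- A unit direction is needed even when w = 0, that is, when g = ±v.
  obtain ⟨e, he, hwe⟩ := exists_unit_eq_norm_smul (by omega) w
  have hwy (y : UnitSphere m) : ⟪w, y.1⟫ = ‖w‖ * ⟪e, y.1⟫ := by
    conv_lhs => rw [hwe]
    rw [inner_smul_left]
    simp
  rcases hpromise with hclose | hfar
  -- On S the report is forced to be `atMost` whatever the oracle does on ties, so the counter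
  -- dominates the number of samples in S.
  · set S : Set (UnitSphere m) := {y | ⟪gradient f x, u y⟫ < -Δ} with hS
    have hSm : MeasurableSet S := measurableSet_lt hmeas measurable_const
    have hSp : 4 / 5 ≤ (uniformSphere m).real S := by
      have hcap : MeasurableSet {y : UnitSphere m | 49 / 50 / √(m : ℝ) < ⟪e, y.1⟫} :=
        measurableSet_lt (by fun_prop) (by fun_prop)
      have h1 := uniformSphere_cap_le hm e he
      have h2 := probReal_compl_eq_one_sub (μ := uniformSphere m) hcap
      refine le_trans (by linarith) (measureReal_mono (μ := uniformSphere m)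
        (s₁ := {y : UnitSphere m | 49 / 50 / √(m : ℝ) < ⟪e, y.1⟫}ᶜ) fun y hy => ?_)
      simp only [Set.mem_compl_iff, Set.mem_ofPred_eq, not_lt] at hy
      have h3 := inner_bound_of_close hm' hε hεsq (norm_nonneg w) hgw (by
        rw [← hdist]
        exact pow_le_pow_left₀ (norm_nonneg _) hclose 2)
      have h4 : -a * h 0 + ⟪w, y.1⟫ < -(ε / (64 * √m)) := by
        rw [hwy]
        have := mul_le_mul_of_nonneg_left hy (norm_nonneg w)
        linarith
      have h5 := mul_lt_mul_of_pos_left h4 (div_pos hΓ0 hA0)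
      rw [hS, Set.mem_ofPred_eq, hinner]
      linarith
    refine ⟨_, measurableSet_frequency_le hSm _, two_thirds_le_sampleLaw_frequency_ge hSm hSp,
      fun ys hys => ?_⟩
    rw [run_gradientTest, if_pos]
    · exact hclose
    · rw [le_div_iff₀ hT]
      refine le_trans hys (Finset.sum_le_sum fun i _ => ?_)
      by_cases hi : ys i ∈ S
      · rw [Set.indicator_of_mem hi, if_neg (oracle_ne_one_of_inner_lt hL hΔ0 hf hO (hun _) hi)]
      · rw [Set.indicator_of_notMem hi]
        split_ifs <;> simp
  -- Off S the report is forced to be `atLeast`, so the counter is at most the number of samples in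
  -- S.
  · set S : Set (UnitSphere m) := {y | ⟪gradient f x, u y⟫ ≤ Δ} with hS
    have hSm : MeasurableSet S := measurableSet_le hmeas measurable_const
    have hSp : (uniformSphere m).real S ≤ 31 / 40 := by
      have h1 := le_uniformSphere_cap hm e he
      have h2 := probReal_compl_eq_one_sub (μ := uniformSphere m) hSm
      have h6 : (uniformSphere m).real {y : UnitSphere m | 103 / 200 / √(m : ℝ) < ⟪e, y.1⟫} ≤
          (uniformSphere m).real Sᶜ := by
        refine measureReal_mono fun y hy => ?_
        rw [Set.mem_ofPred_eq] at hy
        have h3 := inner_bound_of_far hm' hε hεsq (norm_nonneg w) hgw (by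
          rw [← hdist]
          have := pow_lt_pow_left₀ hfar (by positivity) two_ne_zero
          linarith)
        have h4 : ε / (64 * √m) < -a * h 0 + ⟪w, y.1⟫ := by
          rw [hwy]
          have := mul_le_mul_of_nonneg_left hy.le (norm_nonneg w)
          linarith
        have h5 := mul_lt_mul_of_pos_left h4 (div_pos hΓ0 hA0)
        rw [hS, Set.mem_compl_iff, Set.mem_ofPred_eq, hinner, not_le]
        linarith
      linarith
    refine ⟨_, (measurableSet_frequency_le hSm _).compl,
      two_thirds_le_sampleLaw_frequency_lt hSm hSp, fun ys hys => ?_⟩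
    rw [run_gradientTest, if_neg]
    · exact hfar
    · rw [le_div_iff₀ hT]
      refine fun hle => hys (le_trans hle (Finset.sum_le_sum fun i _ => ?_))
      by_cases hi : ys i ∈ S
      · rw [Set.indicator_of_mem hi]
        split_ifs <;> simp
      · rw [Set.indicator_of_notMem hi,
          if_pos (oracle_eq_one_of_lt_inner hL hΔ0 hf hO (hun _) (not_le.1 hi))]
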